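/- For $a,b_1,b_2,c_1,c_2\in\mathbb C$ write $(a)_k=a(a+1)\cdots(a+k-1)$ and let $$S(x,y)=\sum_{i,j=0}^{\infty}\frac{(a)_{i+j}(a-c_2+1)_i(b_1)_i(b_2)_j}{(a+b_2-c_2+1)_{i+j}(c_1)_i\,i!\,j!}\,x^i(1-y)^j .$$ Let $\Omega=\{(x,y)\in\mathbb C^2 : x\notin[1,\infty),\ y\notin(-\infty,0]\}$. Olsson's function $F_P(a,b_1,b_2,c_1,c_2;x,y)$ is, for $(x,y)\in\Omega$, the value at $(x,y)$ of the (unique) holomorphic function on $\Omega$ that on $|x|<1$, $|1-y|<1$ equals the sum of the absolutely convergent double series $S(x,y)$. **Theorem.** Assume $$\operatorname{Re} a,\ \operatorname{Re}(a-b_2),\ \operatorname{Re}(b_2+c_1-a),\ \operatorname{Re}(b_2-c_2+1),\ \operatorname{Re}(c_1+c_2-a-1)>0 .$$ For $(x,y)\in\Omega$ put $$I(x,y)=\frac{\Gamma(a+b_2-c_2+1)\,\Gamma(c_1)}{\Gamma(a)\,\Gamma(a-c_2+1)\,\Gamma(b_2-c_2+1)\,\Gamma(c_1+c_2-a-1)}\;y^{-b_2}\int_0^1\!\!\int_0^1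 u^{a-1}(1-u)^{b_2+c_1-a-1}v^{b_2-c_2}(1-v)^{c_1+c_2-a-2}(1-xu)^{-b_1}\bigl(u+(1-u)vy^{-1}\bigr)^{-b_2}\,du\,dv ,$$ where all powers have their principal values. Then for every $(x,y)\in\Omega$ the double integral converges absolutely and $$F_P(a,b_1,b_2,c_1,c_2;x,y)=I(x,y).$$ Moreover, $I$ is the analytic continuation of the double series $S$ to $\Omega$: it is holomorphic on $\Omega$, and for $|x|<1$, $|1-y|<1$ the series $S(x,y)$ converges absolutely with sum $I(x,y)$. -/

import Mathlib

open MeasureTheory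

noncomputable section

namespace Olsson

/-- The Pochhammer symbol `(a)_k = a (a+1) ⋯ (a+k-1)`. -/
def poch (a : ℂ) (k : ℕ) : ℂ := (ascPochhammer ℂ k).eval a

/-- The `(i, j)` term of the double power series at the point `(0, 1)` that defines `F_P`. -/
def term (a b₁ b₂ c₁ c₂ x y : ℂ) (ij : ℕ × ℕ) : ℂ :=
  poch a (ij.1 + ij.2) * poch (a - c₂ + 1) ij.1 * poch b₁ ij.1 * poch b₂ ij.2 /
    (poch (a + b₂ - c₂ + 1) (ij.1 + ij.2) * poch c₁ ij.1 *
      (ij.1.factorial : ℂ) * (ij.2.factorial : ℂ)) * x ^ ij.1 * (1 - y) ^ ij.2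

/-- The region `x ∉ [1, ∞)`, `y ∉ (-∞, 0]` in `ℂ²`. -/
def region : Set (ℂ × ℂ) :=
  {p | (∀ t : ℝ, 1 ≤ t → p.1 ≠ (t : ℂ)) ∧ (∀ t : ℝ, t ≤ 0 → p.2 ≠ (t : ℂ))}

/-- `F` is an analytic continuation to `region` of the double power series of `F_P`: it is
holomorphic (complex differentiable as a function of two variables) on this open set, and on
the polydisc `|x| < 1`, `|1 - y| < 1`, which lies in `region`, the double power series converges
(absolutely, as `HasSum` of complex numbers) to `F`. -/
def IsContinuation (a b₁ b₂ c₁ c₂ : ℂ) (F : ℂ × ℂ → ℂ) : Prop :=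
  DifferentiableOn ℂ F region ∧
    ∀ x y : ℂ, ‖x‖ < 1 → ‖1 - y‖ < 1 → HasSum (term a b₁ b₂ c₁ c₂ x y) (F (x, y))

lemma mem_region_iff (p : ℂ × ℂ) :
    p ∈ region ↔ 1 - p.1 ∈ Complex.slitPlane ∧ p.2 ∈ Complex.slitPlane := by
  have key : ∀ z : ℂ, (∀ t : ℝ, t ≤ 0 → z ≠ (t : ℂ)) ↔ z ∈ Complex.slitPlane := by
    intro z
    rw [Complex.mem_slitPlane_iff]
    constructor
    · intro h
      by_contra hc
      push Not at hc
      exact h z.re hc.1 (Complex.ext (by simp) (by simp [hc.2]))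
    · rintro h t ht rfl
      simp at h
      linarith
  have h1 : (∀ t : ℝ, 1 ≤ t → p.1 ≠ (t : ℂ)) ↔ (∀ t : ℝ, t ≤ 0 → 1 - p.1 ≠ (t : ℂ)) := by
    constructor
    · intro h t ht he
      refine h (1 - t) (by linarith) ?_
      push_cast
      linear_combination -he
    · intro h t ht he
      refine h (1 - t) (by linarith) ?_
      push_cast
      linear_combination -he
  rw [← key, ← key, ← h1]
  rfl

/-- The analytic continuation is unique on `region`. -/
lemma IsContinuation.eqOn {a b₁ b₂ c₁ c₂ : ℂ} {F G : ℂ × ℂ → ℂ}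
    (hF : IsContinuation a b₁ b₂ c₁ c₂ F) (hG : IsContinuation a b₁ b₂ c₁ c₂ G) :
    Set.EqOn F G region := by
  have hso : IsOpen Complex.slitPlane := Complex.isOpen_slitPlane
  have hsc : IsPreconnected Complex.slitPlane :=
    (Complex.starConvex_one_slitPlane.isPathConnected
      (Or.inl (by simp))).isConnected.isPreconnected
  -- The identity theorem, in the form used for both variables.
  have ident : ∀ f g : ℂ → ℂ, DifferentiableOn ℂ f Complex.slitPlane →
      DifferentiableOn ℂ g Complex.slitPlane → (∀ z, ‖1 - z‖ < 1 → f z = g z) →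
      Set.EqOn f g Complex.slitPlane := by
    intro f g hf hg h
    refine (hf.analyticOnNhd hso).eqOn_of_preconnected_of_eventuallyEq
      (hg.analyticOnNhd hso) hsc (z₀ := 1) (by simp) ?_
    filter_upwards [Metric.ball_mem_nhds (1 : ℂ) one_pos] with z hz
    refine h z ?_
    rw [Metric.mem_ball, dist_eq_norm, norm_sub_rev] at hz
    exact hz
  have hball : ∀ z : ℂ, ‖1 - z‖ < 1 → z ∈ Complex.slitPlane := by
    intro z hz
    refine Or.inl ?_
    have := (Complex.re_le_norm (1 - z)).trans_lt hz
    simp at this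
    linarith
  have dx : ∀ H : ℂ × ℂ → ℂ, DifferentiableOn ℂ H region → ∀ y ∈ Complex.slitPlane,
      DifferentiableOn ℂ (fun z => H (1 - z, y)) Complex.slitPlane := by
    intro H hH y hy
    refine hH.comp (f := fun z : ℂ => ((1 - z, y) : ℂ × ℂ)) (by fun_prop) ?_
    intro z hz
    rw [mem_region_iff]
    simpa using ⟨hz, hy⟩
  have dy : ∀ H : ℂ × ℂ → ℂ, DifferentiableOn ℂ H region → ∀ x, 1 - x ∈ Complex.slitPlane →
      DifferentiableOn ℂ (fun z => H (x, z)) Complex.slitPlane := by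
    intro H hH x hx
    refine hH.comp (f := fun z : ℂ => ((x, z) : ℂ × ℂ)) (by fun_prop) ?_
    intro z hz
    rw [mem_region_iff]
    exact ⟨hx, hz⟩
  have step : ∀ y : ℂ, ‖1 - y‖ < 1 → ∀ x, 1 - x ∈ Complex.slitPlane → F (x, y) = G (x, y) := by
    intro y hy x hx
    have := ident _ _ (dx F hF.1 y (hball y hy)) (dx G hG.1 y (hball y hy))
      (fun z hz => (hF.2 (1 - z) y hz hy).unique (hG.2 (1 - z) y hz hy)) hx
    simpa using this
  rintro ⟨x, y⟩ hp
  rw [mem_region_iff] at hp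
  exact ident _ _ (dy F hF.1 x hp.1) (dy G hG.1 x hp.1) (fun z hz => step z hz x hp.1) hp.2

open Classical in
/-- Olsson's function `F_P(a, b₁, b₂, c₁, c₂; x, y)`: the value at `(x, y)` of the analytic
continuation of the double power series to `region` (unique there by `IsContinuation.eqOn`). -/
def FP (a b₁ b₂ c₁ c₂ x y : ℂ) : ℂ :=
  if h : ∃ F : ℂ × ℂ → ℂ, IsContinuation a b₁ b₂ c₁ c₂ F then h.choose (x, y) else 0

/-- The integrand at `(u, v)`, with principal values of all powers. -/
def integrand (a b₁ b₂ c₁ c₂ x y : ℂ) (p : ℝ × ℝ) : ℂ :=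
  (p.1 : ℂ) ^ (a - 1) * (1 - (p.1 : ℂ)) ^ (b₂ + c₁ - a - 1) *
    (p.2 : ℂ) ^ (b₂ - c₂) * (1 - (p.2 : ℂ)) ^ (c₁ + c₂ - a - 2) *
    (1 - x * (p.1 : ℂ)) ^ (-b₁) *
    ((p.1 : ℂ) + (1 - (p.1 : ℂ)) * (p.2 : ℂ) * y⁻¹) ^ (-b₂)

/-- The square `[0, 1] × [0, 1]`. -/
def square : Set (ℝ × ℝ) := Set.Icc 0 1 ×ˢ Set.Icc 0 1

/-- The Gamma factor times `y ^ (-b₂)` times the double integral over the square. -/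
def eulerIntegral (a b₁ b₂ c₁ c₂ x y : ℂ) : ℂ :=
  Complex.Gamma (a + b₂ - c₂ + 1) * Complex.Gamma c₁ /
      (Complex.Gamma a * Complex.Gamma (a - c₂ + 1) * Complex.Gamma (b₂ - c₂ + 1) *
        Complex.Gamma (c₁ + c₂ - a - 1)) *
    y ^ (-b₂) * ∫ p in square, integrand a b₁ b₂ c₁ c₂ x y p

end Olsson

end

namespace Olsson

open Complex Set Filter Topology

/-! Put D = u + (1-u)v. On the bidisc, y(u + (1-u)v/y) = D - (1-y)u, so y^(-b₂) times the last
factor of the integrand is D^(-b₂) (1 - (1-y)u/D)^(-b₂). Since 0 < u ≤ D, this power and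
(1-xu)^(-b₁) expand in binomial series, and integration is termwise by domination. Because (b₂-c₂+1)
+ (c₁+c₂-a-1) = b₂+c₁-a, replacing v by D turns each term into a Dirichlet integral over 0 < u < D <
1, a product of two Beta functions (`integral_jacobi_mul_diag`). Its Gamma quotients give the
Pochhammer symbols of S (`hasSum_term`). On all of Ω, the variables 1-x and 1/y lie in the slit
plane. There the kernel and its partial derivatives are locally uniformly O(|D^(-b₂)|), which is
integrable against the weight because D ≥ u and Re(a-b₂) > 0. Differentiation under the integral
gives holomorphy (`differentiableOn_eulerIntegral`), and `IsContinuation.eqOn` identifies the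
integral with F_P. -/

/-! ### Pochhammer symbols and the binomial series. -/

lemma Gamma_add_natCast_eq {z : ℂ} (hz : 0 < z.re) (n : ℕ) :
    Gamma (z + n) = poch z n * Gamma z := by
  rw [poch, ← Gamma_add_nat_div_Gamma_eq z (fun k hk => ?_),
    div_mul_cancel₀ _ (Gamma_ne_zero_of_re_pos hz)]
  rw [hk] at hz
  simp at hz
  linarith [(Nat.cast_nonneg k : (0 : ℝ) ≤ k)]

lemma choose_add_sub_one_eq (b : ℂ) (n : ℕ) :
    Ring.choose (b + n - 1) n = poch b n / n.factorial := by
  rw [eq_div_iff (by exact_mod_cast n.factorial_ne_zero), mul_comm, ← nsmul_eq_mul, Ring.choose,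
    Ring.factorial_nsmul_multichoose_eq_ascPochhammer, poch,
    Polynomial.ascPochhammer_smeval_eq_eval]
  congr 1
  ring

lemma summable_norm_binomial (b : ℂ) {z : ℂ} (hz : ‖z‖ < 1) :
    Summable fun n : ℕ => ‖poch b n / n.factorial * z ^ n‖ := by
  have h := one_div_one_sub_cpow_hasFPowerSeriesOnBall_zero b
  have := FormalMultilinearSeries.summable_norm_apply _ (x := z) (Metric.eball_subset_eball h.r_le
    (by rw [← ENNReal.ofReal_one, Metric.eball_ofReal]; simpa using hz))
  simpa [FormalMultilinearSeries.ofScalars, choose_add_sub_one_eq, -norm_mul, -norm_div] using this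

lemma hasSum_binomial (b : ℂ) {z : ℂ} (hz : ‖z‖ < 1) :
    HasSum (fun n : ℕ => poch b n / n.factorial * z ^ n) ((1 - z) ^ (-b)) := by
  have h := (one_div_one_sub_cpow_hasFPowerSeriesOnBall_zero b).hasSum (y := z)
    (by rw [← ENNReal.ofReal_one, Metric.eball_ofReal]; simpa using hz)
  simpa [FormalMultilinearSeries.ofScalars, choose_add_sub_one_eq, cpow_neg] using h

/-! ### Principal powers on the slit plane. -/

lemma ofReal_mul_cpow {r : ℝ} (hr : 0 < r) {z : ℂ} (hz : z ≠ 0) (b : ℂ) :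
    ((r : ℂ) * z) ^ b = (r : ℂ) ^ b * z ^ b := by
  rw [cpow_def_of_ne_zero (mul_ne_zero (by exact_mod_cast hr.ne') hz),
    cpow_def_of_ne_zero (by exact_mod_cast hr.ne'), cpow_def_of_ne_zero hz, ← Complex.exp_add,
    log_ofReal_mul hr hz, ofReal_log hr.le]
  ring_nf

/-- Used with (t, s) = (1-u, u), w = 1-x for the base 1-xu, and with (t, s) = (u, (1-u)v), w = 1/y
for the other base. -/
lemma add_smul_mem_slitPlane {w : ℂ} (hw : w ∈ slitPlane) {t s : ℝ} (ht : 0 ≤ t) (hs : 0 ≤ s)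
    (hts : 0 < t + s) : (t : ℂ) + s * w ∈ slitPlane := by
  rw [mem_slitPlane_iff] at hw ⊢
  simp only [add_re, ofReal_re, re_ofReal_mul, add_im, ofReal_im, im_ofReal_mul, zero_add]
  rcases hs.eq_or_lt with rfl | hs
  · left; simpa using hts
  · rcases hw with h | h
    · left; positivity
    · right; exact mul_ne_zero hs.ne' h

/-- Powers of `t + s w` are controlled by powers of `t + s`, uniformly for `w` in a compact
subset of the slit plane. -/
lemma exists_norm_cpow_le {K : Set ℂ} (hK : IsCompact K) (hKs : K ⊆ slitPlane) (b : ℂ) :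
    ∃ C : ℝ, 0 ≤ C ∧ ∀ w ∈ K, ∀ t s : ℝ, 0 ≤ t → 0 ≤ s → 0 < t + s →
      ‖((t : ℂ) + s * w) ^ b‖ ≤ C * (t + s) ^ b.re := by
  -- By homogeneity it is enough to bound the power on the segments from 1 to points of K, which
  -- sweep out a compact subset of the slit plane.
  have hc : ContinuousOn (fun p : ℝ × ℂ => (((1 - p.1 : ℝ) : ℂ) + p.1 * p.2) ^ b)
      (Icc 0 1 ×ˢ K) := by
    refine ContinuousOn.cpow_const (by fun_prop) ?_
    rintro ⟨s, w⟩ ⟨hs, hw⟩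
    exact add_smul_mem_slitPlane (hKs hw) (by linarith [hs.2]) hs.1 (by norm_num)
  obtain ⟨C, hC⟩ := (isCompact_Icc.prod hK).exists_bound_of_continuousOn hc
  refine ⟨max C 0, le_max_right _ _, fun w hw t s ht hs hts => ?_⟩
  have h1 : (t : ℂ) + s * w =
      ((t + s : ℝ) : ℂ) * (((1 - s / (t + s) : ℝ) : ℂ) + ((s / (t + s) : ℝ) : ℂ) * w) := by
    have : (t : ℂ) + s ≠ 0 := by exact_mod_cast hts.ne'
    push_cast
    field_simp
    ring
  have hq : s / (t + s) ∈ Icc (0 : ℝ) 1 := ⟨by positivity, (div_le_one hts).2 (by linarith)⟩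
  have hne := slitPlane_ne_zero (add_smul_mem_slitPlane (hKs hw) (t := 1 - s / (t + s))
    (by linarith [hq.2]) hq.1 (by norm_num))
  rw [h1, ofReal_mul_cpow hts hne, norm_mul, norm_cpow_eq_rpow_re_of_pos hts, mul_comm]
  gcongr
  exact (hC (s / (t + s), w) ⟨hq, hw⟩).trans (le_max_left _ _)

/-! ### Weights on the unit square and their integrability. -/

/-- The open unit square. -/
def openSquare : Set (ℝ × ℝ) := Ioo 0 1 ×ˢ Ioo 0 1

/-- The algebraic weight `u^(a-1) (1-u)^(e-1) v^(g-1) (1-v)^(d-1)` on the unit square. -/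
noncomputable def jacobi (a e g d : ℂ) (p : ℝ × ℝ) : ℂ :=
  (p.1 : ℂ) ^ (a - 1) * (1 - (p.1 : ℂ)) ^ (e - 1) *
    ((p.2 : ℂ) ^ (g - 1) * (1 - (p.2 : ℂ)) ^ (d - 1))

/-- The real number `u + (1 - u) v`, which lies in `(0, 1)` on the open unit square. -/
noncomputable def diag (p : ℝ × ℝ) : ℝ := p.1 + (1 - p.1) * p.2

lemma measurableSet_openSquare : MeasurableSet openSquare :=
  measurableSet_Ioo.prod measurableSet_Ioo

lemma square_ae_eq : square =ᵐ[volume] openSquare :=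
  Measure.set_prod_ae_eq Ioo_ae_eq_Icc.symm Ioo_ae_eq_Icc.symm

lemma diag_bounds {p : ℝ × ℝ} (hp : p ∈ openSquare) :
    p.1 ≤ diag p ∧ 0 < diag p ∧ diag p < 1 := by
  obtain ⟨⟨h1, h2⟩, h3, h4⟩ := hp
  unfold diag
  refine ⟨?_, ?_, ?_⟩ <;> nlinarith

@[fun_prop]
lemma measurable_jacobi (a e g d : ℂ) : Measurable (jacobi a e g d) := by
  unfold jacobi; fun_prop

@[fun_prop]
lemma measurable_diag : Measurable diag := by unfold diag; fun_prop

lemma integrableOn_beta {a e : ℂ} (ha : 0 < a.re) (he : 0 < e.re) :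
    IntegrableOn (fun x : ℝ => (x : ℂ) ^ (a - 1) * (1 - (x : ℂ)) ^ (e - 1)) (Ioo 0 1) := by
  have := betaIntegral_convergent ha he
  rwa [intervalIntegrable_iff_integrableOn_Ioo_of_le zero_le_one] at this

lemma integrableOn_jacobi {a e g d : ℂ} (ha : 0 < a.re) (he : 0 < e.re) (hg : 0 < g.re)
    (hd : 0 < d.re) : IntegrableOn (jacobi a e g d) openSquare := by
  have := (integrableOn_beta ha he).integrable.mul_prod (integrableOn_beta hg hd).integrable
  rwa [Measure.prod_restrict] at this

/-- If Re s ≥ 0, then u ≤ D gives |D^(-s)| ≤ |u^(-s)|, which only shifts a to a-s; if Re s ≤ 0, then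
|D^(-s)| ≤ 1. -/
lemma integrableOn_jacobi_mul_diag {a e g d s : ℂ} (ha : 0 < a.re) (he : 0 < e.re)
    (hg : 0 < g.re) (hd : 0 < d.re) (has : 0 < (a - s).re) :
    IntegrableOn (fun p => jacobi a e g d p * (diag p : ℂ) ^ (-s)) openSquare := by
  have hmeas : AEStronglyMeasurable (fun p => jacobi a e g d p * (diag p : ℂ) ^ (-s))
      (volume.restrict openSquare) := by
    refine Measurable.aestronglyMeasurable ?_
    fun_prop
  rcases le_total 0 s.re with hs | hs
  · refine (integrableOn_jacobi has he hg hd).integrable.mono hmeas ?_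
    refine (ae_restrict_mem measurableSet_openSquare).mono fun p hp => ?_
    obtain ⟨h1, h2, h3⟩ := diag_bounds hp
    have hu : 0 < p.1 := hp.1.1
    have hsplit : (p.1 : ℂ) ^ (a - s - 1) = (p.1 : ℂ) ^ (a - 1) * (p.1 : ℂ) ^ (-s) := by
      rw [← cpow_add _ _ (by exact_mod_cast hu.ne')]
      ring_nf
    have hle : ‖(diag p : ℂ) ^ (-s)‖ ≤ ‖(p.1 : ℂ) ^ (-s)‖ := by
      rw [norm_cpow_eq_rpow_re_of_pos h2, norm_cpow_eq_rpow_re_of_pos hu]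
      exact Real.rpow_le_rpow_of_nonpos hu h1 (by simpa using hs)
    calc ‖jacobi a e g d p * (diag p : ℂ) ^ (-s)‖
        ≤ ‖jacobi a e g d p‖ * ‖(p.1 : ℂ) ^ (-s)‖ := by
          rw [norm_mul]; gcongr
      _ = ‖jacobi (a - s) e g d p‖ := by
          simp only [jacobi, hsplit, norm_mul]; ring
  · refine (integrableOn_jacobi ha he hg hd).integrable.mono hmeas ?_
    refine (ae_restrict_mem measurableSet_openSquare).mono fun p hp => ?_
    obtain ⟨h1, h2, h3⟩ := diag_bounds hp
    rw [norm_mul, norm_cpow_eq_rpow_re_of_pos h2]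
    exact mul_le_of_le_one_right (norm_nonneg _)
      (Real.rpow_le_one h2.le h3.le (by simpa using hs))

/-! ### The substitution D = u + (1-u)v and the Dirichlet integral. -/

section Affine

variable {E : Type*} [NormedAddCommGroup E] [NormedSpace ℝ E]

lemma affine_image_Ioo {u : ℝ} (hu : u < 1) :
    (fun v : ℝ => u + (1 - u) * v) '' Ioo 0 1 = Ioo u 1 := by
  have h : 0 < 1 - u := by linarith
  ext D
  constructor
  · rintro ⟨v, ⟨h0, h1⟩, rfl⟩
    constructor <;> simp only <;> nlinarith
  · rintro ⟨h0, h1⟩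
    refine ⟨(D - u) / (1 - u), ⟨div_pos (by linarith) h, (div_lt_one h).2 (by linarith)⟩, ?_⟩
    simp only
    field_simp
    ring

lemma integral_Ioo_affine {u : ℝ} (hu : u < 1) (f : ℝ → E) :
    ∫ D in Ioo u 1, f D = ∫ v in Ioo 0 1, (1 - u) • f (u + (1 - u) * v) := by
  have h : 0 < 1 - u := by linarith
  rw [← affine_image_Ioo hu, integral_image_eq_integral_abs_deriv_smul measurableSet_Ioo
    (f' := fun _ => 1 - u), abs_of_pos h]
  · intro v _
    simpa using (((hasDerivAt_id v).const_mul (1 - u)).const_add u).hasDerivWithinAt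
  · intro v _ w _ hvw
    simpa [h.ne'] using hvw

lemma integrableOn_Ioo_affine {u : ℝ} (hu : u < 1) (f : ℝ → E) :
    IntegrableOn f (Ioo u 1) ↔
      IntegrableOn (fun v => (1 - u) • f (u + (1 - u) * v)) (Ioo 0 1) := by
  have h : 0 < 1 - u := by linarith
  rw [← affine_image_Ioo hu, integrableOn_image_iff_integrableOn_abs_deriv_smul measurableSet_Ioo
    (f' := fun _ => 1 - u), abs_of_pos h]
  · intro v _
    simpa using (((hasDerivAt_id v).const_mul (1 - u)).const_add u).hasDerivWithinAt
  · intro v _ w _ hvw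
    simpa [h.ne'] using hvw

end Affine

/-- The Dirichlet-type density obtained from `jacobi` by the substitution `D = u + (1 - u) v`. -/
noncomputable def simplexDensity (a g d s : ℂ) (u D : ℝ) : ℂ :=
  (u : ℂ) ^ (a - 1) * ((D : ℂ) - u) ^ (g - 1) * ((1 - (D : ℂ)) ^ (d - 1) * (D : ℂ) ^ (-s))

/-- Here D-u = (1-u)v and 1-D = (1-u)(1-v). Together with the Jacobian, the powers of 1-u add up to
1 + (g-1) + (d-1), which forces the exponent parameter g+d. -/
lemma smul_simplexDensity (a g d s : ℂ) {u v : ℝ} (hu : u ∈ Ioo (0 : ℝ) 1)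
    (hv : v ∈ Ioo (0 : ℝ) 1) :
    (1 - u) • simplexDensity a g d s u (u + (1 - u) * v) =
      jacobi a (g + d) g d (u, v) * (diag (u, v) : ℂ) ^ (-s) := by
  have hu' : 0 < 1 - u := by linarith [hu.2]
  have hv' : 0 < 1 - v := by linarith [hv.2]
  have hne : ((1 - u : ℝ) : ℂ) ≠ 0 := by exact_mod_cast hu'.ne'
  have h1 : ((u + (1 - u) * v : ℝ) : ℂ) - u = ((1 - u : ℝ) : ℂ) * (v : ℂ) := by
    push_cast; ring
  have h2 : 1 - ((u + (1 - u) * v : ℝ) : ℂ) = ((1 - u : ℝ) : ℂ) * ((1 - v : ℝ) : ℂ) := by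
    push_cast; ring
  have h3 : ((1 - u : ℝ) : ℂ) ^ (g + d - 1) =
      ((1 - u : ℝ) : ℂ) * ((1 - u : ℝ) : ℂ) ^ (g - 1) * ((1 - u : ℝ) : ℂ) ^ (d - 1) := by
    rw [show g + d - 1 = 1 + (g - 1) + (d - 1) by ring, cpow_add _ _ hne, cpow_add _ _ hne,
      cpow_one]
  simp only [simplexDensity, jacobi, diag]
  rw [h1, h2, mul_cpow_ofReal_nonneg hu'.le hv.1.le, mul_cpow_ofReal_nonneg hu'.le hv'.le,
    real_smul]
  rw [show (1 : ℂ) - u = ((1 - u : ℝ) : ℂ) by push_cast; ring, h3]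
  push_cast
  ring

/-- For fixed D the variable u runs over (0, D), and rescaling by D gives a Beta integral. -/
lemma integral_simplexDensity (a g d s : ℂ) {D : ℝ} (hD : D ∈ Ioo (0 : ℝ) 1) :
    ∫ u in Ioo 0 1, (Ioo u 1).indicator (simplexDensity a g d s u) D =
      betaIntegral a g * ((D : ℂ) ^ (a + g - s - 1) * (1 - (D : ℂ)) ^ (d - 1)) := by
  have hDne : (D : ℂ) ≠ 0 := by exact_mod_cast hD.1.ne'
  have h1 : ∫ u in Ioo 0 1, (Ioo u 1).indicator (simplexDensity a g d s u) D =
      ∫ u in Ioo 0 D, simplexDensity a g d s u D := by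
    have : ∀ u : ℝ, (Ioo u 1).indicator (simplexDensity a g d s u) D =
        (Iio D).indicator (fun u => simplexDensity a g d s u D) u := by
      intro u
      simp only [indicator, mem_Ioo, mem_Iio, hD.2, and_true]
    simp_rw [this]
    rw [setIntegral_indicator measurableSet_Iio, Ioo_inter_Iio, min_eq_right hD.2.le]
  rw [h1]
  simp only [simplexDensity]
  rw [integral_mul_const, ← integral_Ioc_eq_integral_Ioo,
    ← intervalIntegral.integral_of_le hD.1.le, betaIntegral_scaled _ _ hD.1,
    show a + g - s - 1 = (a + g - 1) + (-s) by ring, cpow_add _ _ hDne]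
  ring

lemma integral_jacobi_mul_diag {a g d s : ℂ} (ha : 0 < a.re) (hg : 0 < g.re) (hd : 0 < d.re)
    (has : 0 < (a - s).re) :
    ∫ p in openSquare, jacobi a (g + d) g d p * (diag p : ℂ) ^ (-s) =
      betaIntegral a g * betaIntegral (a + g - s) d := by
  set ν : Measure ℝ := volume.restrict (Ioo 0 1) with hν
  have hprod : (volume : Measure (ℝ × ℝ)).restrict openSquare = ν.prod ν :=
    (Measure.prod_restrict _ _).symm
  have hG := (integrableOn_jacobi_mul_diag (e := g + d) ha (by rw [add_re]; positivity) hg hd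
    has).integrable
  rw [hprod] at hG ⊢
  -- Extension by zero from the triangle u < D < 1 to the square, so that Fubini applies to a
  -- product measure.
  set F : ℝ × ℝ → ℂ := fun p => (Ioo p.1 1).indicator (simplexDensity a g d s p.1) p.2 with hF
  have hFmeas : Measurable F := by
    have : F = {p : ℝ × ℝ | p.1 < p.2 ∧ p.2 < 1}.indicator
        (fun p => simplexDensity a g d s p.1 p.2) := by
      ext p; simp only [hF, indicator, mem_Ioo, mem_ofPred_eq]
    rw [this]
    refine Measurable.indicator (by unfold simplexDensity; fun_prop) ?_
    exact (measurableSet_lt measurable_fst measurable_snd).inter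
      (measurableSet_lt measurable_snd measurable_const)
  have hinner : ∀ u ∈ Ioo (0 : ℝ) 1, Ioo (0 : ℝ) 1 ∩ Ioo u 1 = Ioo u 1 := fun u hu =>
    inter_eq_right.2 (Ioo_subset_Ioo_left hu.1.le)
  have hsub : ∀ u ∈ Ioo (0 : ℝ) 1, ∫ D, F (u, D) ∂ν =
      ∫ v, jacobi a (g + d) g d (u, v) * (diag (u, v) : ℂ) ^ (-s) ∂ν := by
    intro u hu
    simp only [hF, hν]
    rw [setIntegral_indicator measurableSet_Ioo, hinner u hu, integral_Ioo_affine hu.2]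
    exact setIntegral_congr_fun measurableSet_Ioo fun v hv => smul_simplexDensity a g d s hu hv
  have hsubn : ∀ u ∈ Ioo (0 : ℝ) 1, ∫ D, ‖F (u, D)‖ ∂ν =
      ∫ v, ‖jacobi a (g + d) g d (u, v) * (diag (u, v) : ℂ) ^ (-s)‖ ∂ν := by
    intro u hu
    simp only [hF, hν, norm_indicator_eq_indicator_norm]
    rw [setIntegral_indicator measurableSet_Ioo, hinner u hu, integral_Ioo_affine hu.2]
    refine setIntegral_congr_fun measurableSet_Ioo fun v hv => ?_
    simp only [← smul_simplexDensity a g d s hu hv, norm_smul, smul_eq_mul, Real.norm_eq_abs,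
      abs_of_pos (show 0 < 1 - u by linarith [hu.2])]
  have hmem : ∀ᵐ u ∂ν, u ∈ Ioo (0 : ℝ) 1 := ae_restrict_mem measurableSet_Ioo
  -- Integrability transfers from the (u, v) picture because the inner integrals of the norms agree.
  have hFint : Integrable F (ν.prod ν) := by
    rw [integrable_prod_iff hFmeas.aestronglyMeasurable]
    rw [integrable_prod_iff hG.aestronglyMeasurable] at hG
    refine ⟨?_, hG.2.congr (hmem.mono fun u hu => (hsubn u hu).symm)⟩
    filter_upwards [hmem, hG.1] with u hu hGu
    simp only [hF, hν]
    rw [integrable_indicator_iff measurableSet_Ioo, IntegrableOn,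
      Measure.restrict_restrict measurableSet_Ioo, inter_comm, hinner u hu, ← IntegrableOn,
      integrableOn_Ioo_affine hu.2]
    exact IntegrableOn.congr_fun hGu (fun v hv => (smul_simplexDensity a g d s hu hv).symm)
      measurableSet_Ioo
  calc ∫ p, jacobi a (g + d) g d p * (diag p : ℂ) ^ (-s) ∂ν.prod ν
      = ∫ u, ∫ v, jacobi a (g + d) g d (u, v) * (diag (u, v) : ℂ) ^ (-s) ∂ν ∂ν :=
        integral_prod _ hG
    _ = ∫ u, ∫ D, F (u, D) ∂ν ∂ν := integral_congr_ae (hmem.mono fun u hu => (hsub u hu).symm)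
    _ = ∫ D, ∫ u, F (u, D) ∂ν ∂ν := integral_integral_swap hFint
    _ = ∫ D, betaIntegral a g * ((D : ℂ) ^ (a + g - s - 1) * (1 - (D : ℂ)) ^ (d - 1)) ∂ν :=
        integral_congr_ae (hmem.mono fun D hD => integral_simplexDensity a g d s hD)
    _ = betaIntegral a g * betaIntegral (a + g - s) d := by
        rw [integral_const_mul, hν, ← integral_Ioc_eq_integral_Ioo,
          ← intervalIntegral.integral_of_le zero_le_one]
        rfl

lemma integral_jacobi_mul_diag_eq_Gamma {a g d s : ℂ} (ha : 0 < a.re) (hg : 0 < g.re)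
    (hd : 0 < d.re) (has : 0 < (a - s).re) :
    ∫ p in openSquare, jacobi a (g + d) g d p * (diag p : ℂ) ^ (-s) =
      Gamma a * Gamma g * Gamma d * Gamma (a + g - s) /
        (Gamma (a + g) * Gamma (a + g + d - s)) := by
  have h1 : 0 < (a + g).re := by rw [add_re]; positivity
  have h2 : 0 < (a + g - s).re := by simp only [sub_re, add_re] at *; linarith
  have h3 : 0 < (a + g + d - s).re := by simp only [sub_re, add_re] at *; linarith
  rw [integral_jacobi_mul_diag ha hg hd has, eq_div_iff (mul_ne_zero
    (Gamma_ne_zero_of_re_pos h1) (Gamma_ne_zero_of_re_pos h3))]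
  have e1 := Gamma_mul_Gamma_eq_betaIntegral ha hg
  have e2 := Gamma_mul_Gamma_eq_betaIntegral h2 hd
  rw [show a + g - s + d = a + g + d - s by ring] at e2
  linear_combination (-Gamma d * Gamma (a + g - s)) * e1 -
    (Gamma (a + g) * betaIntegral a g) * e2

/-! ### Expansion of the integrand and termwise integration. -/

lemma integrand_eq (a b₁ b₂ c₁ c₂ x y : ℂ) (p : ℝ × ℝ) :
    integrand a b₁ b₂ c₁ c₂ x y p =
      jacobi a (b₂ + c₁ - a) (b₂ - c₂ + 1) (c₁ + c₂ - a - 1) p *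
        ((1 - x * p.1) ^ (-b₁) * ((p.1 : ℂ) + (1 - p.1) * p.2 * y⁻¹) ^ (-b₂)) := by
  simp only [integrand, jacobi]
  rw [show b₂ - c₂ + 1 - 1 = b₂ - c₂ by ring,
    show c₁ + c₂ - a - 1 - 1 = c₁ + c₂ - a - 2 by ring]
  ring

/-- Both arguments lie in (-π/2, π/2), so their sum does not cross the branch cut. -/
lemma mul_cpow_of_re_pos {z w : ℂ} (hz : 0 < z.re) (hw : 0 < w.re) (b : ℂ) :
    (z * w) ^ b = z ^ b * w ^ b := by
  have hz0 : z ≠ 0 := by rintro rfl; simp at hz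
  have hw0 : w ≠ 0 := by rintro rfl; simp at hw
  have h1 := abs_lt.1 (abs_arg_lt_pi_div_two_iff.2 (Or.inl hz))
  have h2 := abs_lt.1 (abs_arg_lt_pi_div_two_iff.2 (Or.inl hw))
  rw [cpow_def_of_ne_zero (mul_ne_zero hz0 hw0), cpow_def_of_ne_zero hz0,
    cpow_def_of_ne_zero hw0, ← Complex.exp_add,
    log_mul hz0 hw0 ⟨by linarith [h1.1, h2.1], by linarith [h1.2, h2.2]⟩, add_mul]

lemma re_pos_of_norm_one_sub_lt {y : ℂ} (hy : ‖1 - y‖ < 1) : 0 < y.re := by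
  have := (re_le_norm (1 - y)).trans_lt hy
  simp at this
  exact this

lemma norm_mul_div_diag_lt {z : ℂ} (hz : ‖z‖ < 1) {p : ℝ × ℝ} (hp : p ∈ openSquare) :
    ‖z * ((p.1 / diag p : ℝ) : ℂ)‖ < 1 := by
  obtain ⟨h1, h2, -⟩ := diag_bounds hp
  have h0 : 0 ≤ p.1 / diag p := div_nonneg hp.1.1.le h2.le
  rw [norm_mul, norm_real, Real.norm_of_nonneg h0]
  exact (mul_le_of_le_one_right (norm_nonneg _) ((div_le_one h2).2 h1)).trans_lt hz

/-- Both bases on the left have positive real part, since Re y > 0 implies Re(1/y) > 0; hence the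
principal powers multiply. -/
lemma cpow_mul_cpow_eq {y : ℂ} (hy : ‖1 - y‖ < 1) (b : ℂ) {p : ℝ × ℝ} (hp : p ∈ openSquare) :
    y ^ (-b) * ((p.1 : ℂ) + (1 - p.1) * p.2 * y⁻¹) ^ (-b) =
      (diag p : ℂ) ^ (-b) * (1 - (1 - y) * ((p.1 / diag p : ℝ) : ℂ)) ^ (-b) := by
  obtain ⟨h1, h2, -⟩ := diag_bounds hp
  have hyre := re_pos_of_norm_one_sub_lt hy
  have hy0 : y ≠ 0 := by rintro rfl; simp at hyre
  have hD : (diag p : ℂ) ≠ 0 := by exact_mod_cast h2.ne'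
  have hlt := norm_mul_div_diag_lt hy hp
  have hne : 1 - (1 - y) * ((p.1 / diag p : ℝ) : ℂ) ≠ 0 := by
    intro h
    rw [← sub_eq_zero.1 h] at hlt
    simp at hlt
  have hre : 0 < ((p.1 : ℂ) + (1 - p.1) * p.2 * y⁻¹).re := by
    have : (p.1 : ℂ) + (1 - p.1) * p.2 * y⁻¹ =
        (p.1 : ℂ) + (((1 - p.1) * p.2 : ℝ) : ℂ) * y⁻¹ := by push_cast; ring
    rw [this, add_re, re_ofReal_mul, ofReal_re, inv_re]
    have hs : 0 ≤ (1 - p.1) * p.2 := mul_nonneg (by linarith [hp.1.2]) hp.2.1.le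
    have hi : 0 ≤ y.re / normSq y := div_nonneg hyre.le (normSq_nonneg y)
    have := mul_nonneg hs hi
    linarith [hp.1.1]
  rw [← mul_cpow_of_re_pos hyre hre, ← ofReal_mul_cpow h2 hne]
  congr 1
  rw [ofReal_div]
  field_simp
  simp only [diag]
  push_cast
  ring

/-- The `(i, j)` term of the expansion of `y ^ (-b₂)` times the integrand in powers of `x` and
`1 - y`. -/
noncomputable def expansionTerm (a b₁ b₂ e g d x y : ℂ) (ij : ℕ × ℕ) (p : ℝ × ℝ) : ℂ :=
  jacobi a e g d p * (diag p : ℂ) ^ (-b₂) *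
    ((poch b₁ ij.1 / ij.1.factorial * (x * p.1) ^ ij.1) *
      (poch b₂ ij.2 / ij.2.factorial * ((1 - y) * ((p.1 / diag p : ℝ) : ℂ)) ^ ij.2))

@[fun_prop]
lemma measurable_expansionTerm (a b₁ b₂ e g d x y : ℂ) (ij : ℕ × ℕ) :
    Measurable (expansionTerm a b₁ b₂ e g d x y ij) := by
  unfold expansionTerm; fun_prop

/-- The monomials u^i (u/D)^j are absorbed as a ↦ a+i+j and b₂ ↦ b₂+j, so each term is again of
Dirichlet type. -/
lemma expansionTerm_eq (a b₁ b₂ e g d x y : ℂ) (ij : ℕ × ℕ) {p : ℝ × ℝ} (hp : p ∈ openSquare) :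
    expansionTerm a b₁ b₂ e g d x y ij p =
      (poch b₁ ij.1 / ij.1.factorial * x ^ ij.1) * (poch b₂ ij.2 / ij.2.factorial * (1 - y) ^ ij.2) *
        (jacobi (a + (ij.1 + ij.2 : ℕ)) e g d p * (diag p : ℂ) ^ (-(b₂ + ij.2))) := by
  obtain ⟨-, h2, -⟩ := diag_bounds hp
  have hu : (p.1 : ℂ) ≠ 0 := by exact_mod_cast hp.1.1.ne'
  have hD : (diag p : ℂ) ≠ 0 := by exact_mod_cast h2.ne'
  have e1 : (p.1 : ℂ) ^ (a + (ij.1 + ij.2 : ℕ) - 1) =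
      (p.1 : ℂ) ^ (a - 1) * (p.1 : ℂ) ^ ij.1 * (p.1 : ℂ) ^ ij.2 := by
    rw [← cpow_natCast, ← cpow_natCast, ← cpow_add _ _ hu, ← cpow_add _ _ hu]
    congr 1
    push_cast
    ring
  have e2 : (diag p : ℂ) ^ (-(b₂ + ij.2)) = (diag p : ℂ) ^ (-b₂) / (diag p : ℂ) ^ ij.2 := by
    rw [neg_add, cpow_add _ _ hD, cpow_neg _ (ij.2 : ℂ), cpow_natCast, div_eq_mul_inv]
  simp only [expansionTerm, jacobi, e1, e2, ofReal_div, mul_pow, div_pow]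
  ring

/-- Since u ≤ 1 and u/D ≤ 1, the majorant separates into a function of i, a function of j and a
fixed integrable function. -/
lemma norm_expansionTerm_le (a b₁ b₂ e g d x y : ℂ) (ij : ℕ × ℕ) {p : ℝ × ℝ}
    (hp : p ∈ openSquare) :
    ‖expansionTerm a b₁ b₂ e g d x y ij p‖ ≤
      ‖poch b₁ ij.1 / ij.1.factorial * x ^ ij.1‖ * ‖poch b₂ ij.2 / ij.2.factorial * (1 - y) ^ ij.2‖ *
        ‖jacobi a e g d p * (diag p : ℂ) ^ (-b₂)‖ := by
  obtain ⟨h1, h2, -⟩ := diag_bounds hp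
  have hu : ‖(p.1 : ℂ)‖ ≤ 1 := by
    rw [norm_real, Real.norm_of_nonneg hp.1.1.le]; exact hp.1.2.le
  have hq : ‖((p.1 / diag p : ℝ) : ℂ)‖ ≤ 1 := by
    rw [norm_real, Real.norm_of_nonneg (div_nonneg hp.1.1.le h2.le)]; exact (div_le_one h2).2 h1
  have hui : ‖(p.1 : ℂ)‖ ^ ij.1 ≤ 1 := pow_le_one₀ (norm_nonneg _) hu
  have hqj : ‖((p.1 / diag p : ℝ) : ℂ)‖ ^ ij.2 ≤ 1 := pow_le_one₀ (norm_nonneg _) hq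
  have key : ‖(p.1 : ℂ)‖ ^ ij.1 * ‖((p.1 / diag p : ℝ) : ℂ)‖ ^ ij.2 ≤ 1 :=
    mul_le_one₀ hui (by positivity) hqj
  calc ‖expansionTerm a b₁ b₂ e g d x y ij p‖
      = ‖poch b₁ ij.1 / ij.1.factorial * x ^ ij.1‖ *
          ‖poch b₂ ij.2 / ij.2.factorial * (1 - y) ^ ij.2‖ *
          ‖jacobi a e g d p * (diag p : ℂ) ^ (-b₂)‖ *
          (‖(p.1 : ℂ)‖ ^ ij.1 * ‖((p.1 / diag p : ℝ) : ℂ)‖ ^ ij.2) := by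
        simp only [expansionTerm, norm_mul, norm_pow]; ring
    _ ≤ _ := mul_le_of_le_one_right (by positivity) key

lemma hasSum_expansionTerm (a b₁ b₂ c₁ c₂ : ℂ) {x y : ℂ} (hx : ‖x‖ < 1) (hy : ‖1 - y‖ < 1)
    {p : ℝ × ℝ} (hp : p ∈ openSquare) :
    HasSum (fun ij => expansionTerm a b₁ b₂ (b₂ + c₁ - a) (b₂ - c₂ + 1) (c₁ + c₂ - a - 1) x y ij p)
      (y ^ (-b₂) * integrand a b₁ b₂ c₁ c₂ x y p) := by
  have hxu : ‖x * (p.1 : ℂ)‖ < 1 := by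
    rw [norm_mul, norm_real, Real.norm_of_nonneg hp.1.1.le]
    exact (mul_le_of_le_one_right (norm_nonneg _) hp.1.2.le).trans_lt hx
  have hyu := norm_mul_div_diag_lt hy hp
  have hs := summable_mul_of_summable_norm (summable_norm_binomial b₁ hxu)
    (summable_norm_binomial b₂ hyu)
  have hval : y ^ (-b₂) * integrand a b₁ b₂ c₁ c₂ x y p =
      jacobi a (b₂ + c₁ - a) (b₂ - c₂ + 1) (c₁ + c₂ - a - 1) p * (diag p : ℂ) ^ (-b₂) *
        ((1 - x * p.1) ^ (-b₁) * (1 - (1 - y) * ((p.1 / diag p : ℝ) : ℂ)) ^ (-b₂)) := by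
    rw [integrand_eq]
    linear_combination jacobi a (b₂ + c₁ - a) (b₂ - c₂ + 1) (c₁ + c₂ - a - 1) p *
      (1 - x * p.1) ^ (-b₁) * cpow_mul_cpow_eq hy b₂ hp
  rw [hval]
  exact ((hasSum_binomial b₁ hxu).mul (hasSum_binomial b₂ hyu) hs).mul_left _

/-- The double series is obtained by termwise integration. -/
theorem hasSum_term {a b₁ b₂ c₁ c₂ : ℂ}
    (ha : 0 < a.re) (hab : 0 < (a - b₂).re) (hbca : 0 < (b₂ + c₁ - a).re)
    (hbc : 0 < (b₂ - c₂ + 1).re) (hcca : 0 < (c₁ + c₂ - a - 1).re) {x y : ℂ} (hx : ‖x‖ < 1)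
    (hy : ‖1 - y‖ < 1) :
    HasSum (term a b₁ b₂ c₁ c₂ x y) (eulerIntegral a b₁ b₂ c₁ c₂ x y) := by
  set e := b₂ + c₁ - a with he
  set g := b₂ - c₂ + 1 with hg
  set d := c₁ + c₂ - a - 1 with hd
  have hgd : g + d = e := by simp only [he, hg, hd]; ring
  have hbase : Integrable (fun p => jacobi a e g d p * (diag p : ℂ) ^ (-b₂))
      (volume.restrict openSquare) := integrableOn_jacobi_mul_diag ha hbca hbc hcca hab
  have hmem : ∀ᵐ p ∂(volume : Measure (ℝ × ℝ)).restrict openSquare, p ∈ openSquare :=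
    ae_restrict_mem measurableSet_openSquare
  have hbound : ∀ ij : ℕ × ℕ, Integrable (fun p =>
      ‖poch b₁ ij.1 / ij.1.factorial * x ^ ij.1‖ * ‖poch b₂ ij.2 / ij.2.factorial * (1 - y) ^ ij.2‖ *
        ‖jacobi a e g d p * (diag p : ℂ) ^ (-b₂)‖) (volume.restrict openSquare) :=
    fun ij => hbase.norm.const_mul _
  have hle : ∀ ij : ℕ × ℕ, ∀ᵐ p ∂(volume : Measure (ℝ × ℝ)).restrict openSquare,
      ‖expansionTerm a b₁ b₂ e g d x y ij p‖ ≤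
      ‖poch b₁ ij.1 / ij.1.factorial * x ^ ij.1‖ * ‖poch b₂ ij.2 / ij.2.factorial * (1 - y) ^ ij.2‖ *
        ‖jacobi a e g d p * (diag p : ℂ) ^ (-b₂)‖ :=
    fun ij => hmem.mono fun p hp => norm_expansionTerm_le a b₁ b₂ e g d x y ij hp
  have hint : ∀ ij, Integrable (expansionTerm a b₁ b₂ e g d x y ij)
      (volume.restrict openSquare) := fun ij =>
    (hbound ij).mono' (measurable_expansionTerm ..).aestronglyMeasurable (hle ij)
  have hsum : Summable fun ij => ∫ p in openSquare, ‖expansionTerm a b₁ b₂ e g d x y ij p‖ := by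
    refine Summable.of_nonneg_of_le (fun ij => integral_nonneg fun p => norm_nonneg _)
      (fun ij => integral_mono_ae (hint ij).norm (hbound ij) (hle ij)) ?_
    simp_rw [integral_const_mul]
    exact ((summable_norm_binomial b₁ hx).mul_of_nonneg (summable_norm_binomial b₂ hy)
      (fun _ => norm_nonneg _) (fun _ => norm_nonneg _)).mul_right _
  have h := hasSum_integral_of_summable_integral_norm hint hsum
  rw [integral_congr_ae (hmem.mono fun p hp => (hasSum_expansionTerm a b₁ b₂ c₁ c₂ hx hy hp).tsum_eq),
    integral_const_mul] at h
  have h' := h.mul_left (Gamma (a + b₂ - c₂ + 1) * Gamma c₁ /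
    (Gamma a * Gamma (a - c₂ + 1) * Gamma g * Gamma d))
  have hac : 0 < (a - c₂ + 1).re := by
    have : a - c₂ + 1 = (a - b₂) + g := by rw [hg]; ring
    rw [this, add_re]; positivity
  have hc₁ : 0 < c₁.re := by
    have : c₁ = e + (a - b₂) := by rw [he]; ring
    rw [this, add_re]; positivity
  have hag : 0 < (a + b₂ - c₂ + 1).re := by
    have : a + b₂ - c₂ + 1 = a + g := by rw [hg]; ring
    rw [this, add_re]; positivity
  convert! h' using 1
  · ext ⟨i, j⟩
    have hai : 0 < (a + (i + j : ℕ)).re := by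
      rw [add_re, natCast_re]; positivity
    -- The two shifts by j cancel; this is why a-c₂+1 and c₁ carry only the index i in the series.
    have haj : 0 < (a + (i + j : ℕ) - (b₂ + j)).re := by
      have : a + (i + j : ℕ) - (b₂ + j) = (a - b₂) + (i : ℕ) := by push_cast; ring
      rw [this, add_re, natCast_re]; positivity
    have hI := integral_jacobi_mul_diag_eq_Gamma hai hbc hcca haj
    rw [hgd, show a + (i + j : ℕ) + g - (b₂ + j) = (a - c₂ + 1) + (i : ℕ) by
        rw [hg]; push_cast; ring,
      show a + (i + j : ℕ) + g = (a + b₂ - c₂ + 1) + (i + j : ℕ) by rw [hg]; push_cast; ring,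
      show a + b₂ - c₂ + 1 + (i + j : ℕ) + d - (b₂ + j) = c₁ + (i : ℕ) by
        rw [hd]; push_cast; ring,
      Gamma_add_natCast_eq ha, Gamma_add_natCast_eq hac, Gamma_add_natCast_eq hag,
      Gamma_add_natCast_eq hc₁] at hI
    rw [setIntegral_congr_fun measurableSet_openSquare
      (fun p hp => expansionTerm_eq a b₁ b₂ e g d x y (i, j) hp), integral_const_mul, hI]
    have n1 := Gamma_ne_zero_of_re_pos ha
    have n2 := Gamma_ne_zero_of_re_pos hac
    have n3 := Gamma_ne_zero_of_re_pos hbc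
    have n4 := Gamma_ne_zero_of_re_pos hcca
    have n5 := Gamma_ne_zero_of_re_pos hag
    have n6 := Gamma_ne_zero_of_re_pos hc₁
    simp only [term]
    field_simp
  · rw [eulerIntegral, setIntegral_congr_set square_ae_eq, ← mul_assoc]

/-! ### Holomorphy of the Euler integral. -/

lemma hasDerivAt_affine_cpow {w : ℂ} (hw : w ∈ slitPlane) {t s : ℝ} (ht : 0 ≤ t) (hs : 0 ≤ s)
    (hts : 0 < t + s) (b : ℂ) :
    HasDerivAt (fun z : ℂ => ((t : ℂ) + s * z) ^ b) (b * ((t : ℂ) + s * w) ^ (b - 1) * s) w := by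
  have h : HasDerivAt (fun z : ℂ => (t : ℂ) + s * z) s w := by
    simpa using ((hasDerivAt_id w).const_mul (s : ℂ)).const_add (t : ℂ)
  exact h.cpow_const (add_smul_mem_slitPlane hw ht hs hts)

/-- The kernel of the Euler integral as a function of `X = 1 - x` and `w = 1 / y`. -/
noncomputable def eulerKernel (b₁ b₂ : ℂ) (q : ℂ × ℂ) (p : ℝ × ℝ) : ℂ :=
  (((1 - p.1 : ℝ) : ℂ) + p.1 * q.1) ^ (-b₁) *
    ((p.1 : ℂ) + (((1 - p.1) * p.2 : ℝ) : ℂ) * q.2) ^ (-b₂)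

/-- The partial derivative of `eulerKernel` in the first variable. -/
noncomputable def eulerKernelFst (b₁ b₂ : ℂ) (q : ℂ × ℂ) (p : ℝ × ℝ) : ℂ :=
  (-b₁ * (((1 - p.1 : ℝ) : ℂ) + p.1 * q.1) ^ (-b₁ - 1) * p.1) *
    ((p.1 : ℂ) + (((1 - p.1) * p.2 : ℝ) : ℂ) * q.2) ^ (-b₂)

/-- The partial derivative of `eulerKernel` in the second variable. -/
noncomputable def eulerKernelSnd (b₁ b₂ : ℂ) (q : ℂ × ℂ) (p : ℝ × ℝ) : ℂ :=
  (((1 - p.1 : ℝ) : ℂ) + p.1 * q.1) ^ (-b₁) *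
    (-b₂ * ((p.1 : ℂ) + (((1 - p.1) * p.2 : ℝ) : ℂ) * q.2) ^ (-b₂ - 1) *
      (((1 - p.1) * p.2 : ℝ) : ℂ))

@[fun_prop]
lemma measurable_eulerKernel (b₁ b₂ : ℂ) (q : ℂ × ℂ) : Measurable (eulerKernel b₁ b₂ q) := by
  unfold eulerKernel; fun_prop

@[fun_prop]
lemma measurable_eulerKernelFst (b₁ b₂ : ℂ) (q : ℂ × ℂ) :
    Measurable (eulerKernelFst b₁ b₂ q) := by
  unfold eulerKernelFst; fun_prop

@[fun_prop]
lemma measurable_eulerKernelSnd (b₁ b₂ : ℂ) (q : ℂ × ℂ) :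
    Measurable (eulerKernelSnd b₁ b₂ q) := by
  unfold eulerKernelSnd; fun_prop

lemma integrand_eq_eulerKernel (a b₁ b₂ c₁ c₂ x y : ℂ) (p : ℝ × ℝ) :
    integrand a b₁ b₂ c₁ c₂ x y p =
      jacobi a (b₂ + c₁ - a) (b₂ - c₂ + 1) (c₁ + c₂ - a - 1) p *
        eulerKernel b₁ b₂ (1 - x, y⁻¹) p := by
  rw [integrand_eq, eulerKernel]
  push_cast
  ring_nf

lemma hasFDerivAt_eulerKernel (b₁ b₂ : ℂ) {q : ℂ × ℂ} (hq : q ∈ slitPlane ×ˢ slitPlane)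
    {p : ℝ × ℝ} (hp : p ∈ openSquare) :
    HasFDerivAt (fun q => eulerKernel b₁ b₂ q p)
      (eulerKernelFst b₁ b₂ q p • ContinuousLinearMap.fst ℂ ℂ ℂ +
        eulerKernelSnd b₁ b₂ q p • ContinuousLinearMap.snd ℂ ℂ ℂ) q := by
  obtain ⟨-, h2, -⟩ := diag_bounds hp
  have hu := hp.1.1
  have hu' : 0 < 1 - p.1 := by linarith [hp.1.2]
  have h1 := (hasDerivAt_affine_cpow hq.1 hu'.le hu.le (by linarith) (-b₁)).comp_hasFDerivAt q
    (hasFDerivAt_fst (𝕜 := ℂ) (p := q))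
  have h2 := (hasDerivAt_affine_cpow hq.2 hu.le (mul_pos hu' hp.2.1).le h2 (-b₂)).comp_hasFDerivAt
    q (hasFDerivAt_snd (𝕜 := ℂ) (p := q))
  refine (h1.mul h2).congr_fderiv ?_
  ext <;> simp [eulerKernelFst, eulerKernelSnd]; ring

/-- Uniform bounds for the kernel and its partial derivatives on compact sets. -/
lemma exists_eulerKernel_bounds (b₁ b₂ : ℂ) {K : Set (ℂ × ℂ)} (hK : IsCompact K)
    (hKs : K ⊆ slitPlane ×ˢ slitPlane) :
    ∃ C : ℝ, ∀ q ∈ K, ∀ p ∈ openSquare,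
      ‖eulerKernel b₁ b₂ q p‖ ≤ C * ‖(diag p : ℂ) ^ (-b₂)‖ ∧
      ‖eulerKernelFst b₁ b₂ q p‖ ≤ C * ‖(diag p : ℂ) ^ (-b₂)‖ ∧
      ‖eulerKernelSnd b₁ b₂ q p‖ ≤ C * ‖(diag p : ℂ) ^ (-b₂)‖ := by
  have hK1 : IsCompact (Prod.fst '' K) := hK.image continuous_fst
  have hK2 : IsCompact (Prod.snd '' K) := hK.image continuous_snd
  have hs1 : Prod.fst '' K ⊆ slitPlane := by rintro _ ⟨q, hq, rfl⟩; exact (hKs hq).1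
  have hs2 : Prod.snd '' K ⊆ slitPlane := by rintro _ ⟨q, hq, rfl⟩; exact (hKs hq).2
  obtain ⟨A, hA0, hA⟩ := exists_norm_cpow_le hK1 hs1 (-b₁)
  obtain ⟨A', hA0', hA'⟩ := exists_norm_cpow_le hK1 hs1 (-b₁ - 1)
  obtain ⟨B, hB0, hB⟩ := exists_norm_cpow_le hK2 hs2 (-b₂)
  obtain ⟨B', hB0', hB'⟩ := exists_norm_cpow_le hK2 hs2 (-b₂ - 1)
  refine ⟨max (A * B) (max (‖b₁‖ * A' * B) (A * (‖b₂‖ * B'))), fun q hq p hp => ?_⟩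
  obtain ⟨-, hD, -⟩ := diag_bounds hp
  have hu := hp.1.1
  have hu' : 0 < 1 - p.1 := by linarith [hp.1.2]
  have hs := mul_pos hu' hp.2.1
  have hq1 := mem_image_of_mem Prod.fst hq
  have hq2 := mem_image_of_mem Prod.snd hq
  have k1 := hA _ hq1 (1 - p.1) p.1 hu'.le hu.le (by linarith)
  have k1' := hA' _ hq1 (1 - p.1) p.1 hu'.le hu.le (by linarith)
  have k2 := hB _ hq2 p.1 ((1 - p.1) * p.2) hu.le hs.le hD
  have k2' := hB' _ hq2 p.1 ((1 - p.1) * p.2) hu.le hs.le hD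
  -- For the base 1-xu one has t + s = 1, so these bounds are constants.
  rw [sub_add_cancel, Real.one_rpow, mul_one] at k1 k1'
  rw [show p.1 + (1 - p.1) * p.2 = diag p from rfl] at k2 k2'
  have hsD : (1 - p.1) * p.2 ≤ diag p := by unfold diag; linarith
  -- Differentiation costs one power of D, which the inner factor (1-u)v ≤ D restores.
  have k3 : ‖((p.1 : ℂ) + (((1 - p.1) * p.2 : ℝ) : ℂ) * q.2) ^ (-b₂ - 1)‖ * ((1 - p.1) * p.2) ≤
      B' * diag p ^ (-b₂).re := by
    calc _ ≤ B' * diag p ^ (-b₂ - 1).re * diag p := by gcongr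
      _ = B' * diag p ^ (-b₂).re := by
        rw [sub_re, one_re, Real.rpow_sub_one hD.ne']
        field_simp
  have hp1 : ‖(p.1 : ℂ)‖ ≤ 1 := by
    rw [norm_real, Real.norm_of_nonneg hu.le]; exact hp.1.2.le
  rw [norm_cpow_eq_rpow_re_of_pos hD]
  have hDp : 0 ≤ diag p ^ (-b₂).re := by positivity
  refine ⟨?_, ?_, ?_⟩
  · calc ‖eulerKernel b₁ b₂ q p‖ ≤ A * (B * diag p ^ (-b₂).re) := by
          rw [eulerKernel, norm_mul]; gcongr
      _ = A * B * diag p ^ (-b₂).re := by ring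
      _ ≤ _ := by gcongr; exact le_max_left _ _
  · calc ‖eulerKernelFst b₁ b₂ q p‖ ≤ (‖b₁‖ * A' * 1) * (B * diag p ^ (-b₂).re) := by
          rw [eulerKernelFst, norm_mul, norm_mul, norm_mul, norm_neg]; gcongr
      _ = ‖b₁‖ * A' * B * diag p ^ (-b₂).re := by ring
      _ ≤ _ := by gcongr; exact (le_max_left _ _).trans (le_max_right _ _)
  · calc ‖eulerKernelSnd b₁ b₂ q p‖ ≤ A * (‖b₂‖ * (B' * diag p ^ (-b₂).re)) := by
          rw [eulerKernelSnd, norm_mul, norm_mul, norm_mul, norm_neg, norm_real,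
            Real.norm_of_nonneg hs.le, mul_assoc ‖b₂‖]
          gcongr
      _ = A * (‖b₂‖ * B') * diag p ^ (-b₂).re := by ring
      _ ≤ _ := by gcongr; exact (le_max_right _ _).trans (le_max_right _ _)

section

variable {a e g d b₁ b₂ : ℂ}

lemma integrableOn_jacobi_mul_eulerKernel (ha : 0 < a.re) (he : 0 < e.re) (hg : 0 < g.re)
    (hd : 0 < d.re) (hab : 0 < (a - b₂).re) {q : ℂ × ℂ} (hq : q ∈ slitPlane ×ˢ slitPlane) :
    IntegrableOn (fun p => jacobi a e g d p * eulerKernel b₁ b₂ q p) openSquare := by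
  obtain ⟨C, hC⟩ := exists_eulerKernel_bounds b₁ b₂ isCompact_singleton
    (singleton_subset_iff.2 hq)
  refine Integrable.mono' ((integrableOn_jacobi_mul_diag ha he hg hd hab).norm.const_mul C)
    (Measurable.aestronglyMeasurable (by fun_prop)) ?_
  refine (ae_restrict_mem measurableSet_openSquare).mono fun p hp => ?_
  rw [norm_mul, norm_mul, mul_left_comm]
  gcongr
  exact (hC q rfl p hp).1

lemma differentiableAt_integral_eulerKernel (ha : 0 < a.re) (he : 0 < e.re) (hg : 0 < g.re)
    (hd : 0 < d.re) (hab : 0 < (a - b₂).re) {q : ℂ × ℂ} (hq : q ∈ slitPlane ×ˢ slitPlane) :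
    DifferentiableAt ℂ (fun q => ∫ p in openSquare, jacobi a e g d p * eulerKernel b₁ b₂ q p) q := by
  obtain ⟨K, hKc, hKn, hKs⟩ : ∃ K, IsCompact K ∧ K ∈ 𝓝 q ∧ K ⊆ slitPlane ×ˢ slitPlane := by
    obtain ⟨K, hKn, hKs, hKc⟩ := local_compact_nhds
      ((isOpen_slitPlane.prod isOpen_slitPlane).mem_nhds hq)
    exact ⟨K, hKc, hKn, hKs⟩
  obtain ⟨C, hC⟩ := exists_eulerKernel_bounds b₁ b₂ hKc hKs
  refine (hasFDerivAt_integral_of_dominated_of_fderiv_le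
    (μ := volume.restrict openSquare)
    (F := fun q p => jacobi a e g d p * eulerKernel b₁ b₂ q p)
    (F' := fun q p => (jacobi a e g d p * eulerKernelFst b₁ b₂ q p) •
      ContinuousLinearMap.fst ℂ ℂ ℂ + (jacobi a e g d p * eulerKernelSnd b₁ b₂ q p) •
      ContinuousLinearMap.snd ℂ ℂ ℂ)
    -- One C for each partial derivative.
    (bound := fun p => 2 * C * ‖jacobi a e g d p * (diag p : ℂ) ^ (-b₂)‖) hKn
    (Eventually.of_forall fun q => Measurable.aestronglyMeasurable (by fun_prop))
    (integrableOn_jacobi_mul_eulerKernel ha he hg hd hab hq) ?_ ?_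
    ((integrableOn_jacobi_mul_diag ha he hg hd hab).norm.const_mul _) ?_).differentiableAt
  · refine AEStronglyMeasurable.add ?_ ?_ <;>
      exact AEStronglyMeasurable.smul_const (Measurable.aestronglyMeasurable (by fun_prop)) _
  · refine (ae_restrict_mem measurableSet_openSquare).mono fun p hp z hz => ?_
    obtain ⟨-, h1, h2⟩ := hC z hz p hp
    calc _ ≤ ‖jacobi a e g d p * eulerKernelFst b₁ b₂ z p‖ * 1 +
          ‖jacobi a e g d p * eulerKernelSnd b₁ b₂ z p‖ * 1 := by
          refine (norm_add_le _ _).trans ?_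
          rw [norm_smul, norm_smul]
          gcongr
          · exact ContinuousLinearMap.norm_fst_le ..
          · exact ContinuousLinearMap.norm_snd_le ..
      _ ≤ ‖jacobi a e g d p‖ * (C * ‖(diag p : ℂ) ^ (-b₂)‖) +
          ‖jacobi a e g d p‖ * (C * ‖(diag p : ℂ) ^ (-b₂)‖) := by
          rw [mul_one, mul_one, norm_mul, norm_mul]
          gcongr
      _ = _ := by rw [norm_mul]; ring
  · refine (ae_restrict_mem measurableSet_openSquare).mono fun p hp z hz => ?_
    refine ((hasFDerivAt_eulerKernel b₁ b₂ (hKs hz) hp).const_mul (jacobi a e g d p)).congr_fderiv ?_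
    rw [smul_add, smul_smul, smul_smul]

end

/-- Inversion preserves the slit plane: it keeps the sign of the real part and reverses that of the
imaginary part. -/
lemma mem_slitPlane_prod_of_mem_region {p : ℂ × ℂ} (hp : p ∈ region) :
    (1 - p.1, p.2⁻¹) ∈ slitPlane ×ˢ slitPlane := by
  rw [mem_region_iff] at hp
  refine ⟨hp.1, ?_⟩
  have h := hp.2
  have hn : 0 < normSq p.2 := normSq_pos.2 (slitPlane_ne_zero h)
  rw [mem_slitPlane_iff] at h ⊢
  simp only [inv_re, inv_im]
  rcases h with h | h
  · exact Or.inl (div_pos h hn)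
  · exact Or.inr (div_ne_zero (neg_ne_zero.2 h) hn.ne')

theorem integrableOn_integrand {a b₁ b₂ c₁ c₂ : ℂ}
    (ha : 0 < a.re) (hab : 0 < (a - b₂).re) (hbca : 0 < (b₂ + c₁ - a).re)
    (hbc : 0 < (b₂ - c₂ + 1).re) (hcca : 0 < (c₁ + c₂ - a - 1).re) {x y : ℂ}
    (hxy : (x, y) ∈ region) : IntegrableOn (integrand a b₁ b₂ c₁ c₂ x y) square := by
  rw [integrableOn_congr_set_ae square_ae_eq]
  simpa only [← integrand_eq_eulerKernel] using integrableOn_jacobi_mul_eulerKernel (b₁ := b₁)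
    ha hbca hbc hcca hab (mem_slitPlane_prod_of_mem_region hxy)

theorem differentiableOn_eulerIntegral {a b₁ b₂ c₁ c₂ : ℂ}
    (ha : 0 < a.re) (hab : 0 < (a - b₂).re) (hbca : 0 < (b₂ + c₁ - a).re)
    (hbc : 0 < (b₂ - c₂ + 1).re) (hcca : 0 < (c₁ + c₂ - a - 1).re) :
    DifferentiableOn ℂ (fun p : ℂ × ℂ => eulerIntegral a b₁ b₂ c₁ c₂ p.1 p.2) region := by
  intro q hq
  have hq' := mem_slitPlane_prod_of_mem_region hq
  have hq2 : q.2 ∈ slitPlane := ((mem_region_iff q).1 hq).2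
  have hI := (differentiableAt_integral_eulerKernel (b₁ := b₁) ha hbca hbc hcca hab hq').comp q
    (f := fun p : ℂ × ℂ => ((1 - p.1, p.2⁻¹) : ℂ × ℂ))
    ((differentiableAt_fst.const_sub 1).prodMk (differentiableAt_snd.inv (slitPlane_ne_zero hq2)))
  have hy : DifferentiableAt ℂ (fun p : ℂ × ℂ => p.2 ^ (-b₂)) q :=
    differentiableAt_snd.cpow (differentiableAt_const _) hq2
  refine DifferentiableAt.differentiableWithinAt ?_
  have := (hy.const_mul (Gamma (a + b₂ - c₂ + 1) * Gamma c₁ / (Gamma a * Gamma (a - c₂ + 1) *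
    Gamma (b₂ - c₂ + 1) * Gamma (c₁ + c₂ - a - 1)))).mul hI
  refine this.congr_of_eventuallyEq (Eventually.of_forall fun p => ?_)
  simp only [eulerIntegral, setIntegral_congr_set square_ae_eq, integrand_eq_eulerKernel]
  rfl

end Olsson

theorem theorem4p1 (a b₁ b₂ c₁ c₂ : ℂ)
    (ha : 0 < a.re) (hab : 0 < (a - b₂).re) (hbca : 0 < (b₂ + c₁ - a).re)
    (hbc : 0 < (b₂ - c₂ + 1).re) (hcca : 0 < (c₁ + c₂ - a - 1).re) :
    (∀ x y : ℂ, (x, y) ∈ Olsson.region →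
      MeasureTheory.IntegrableOn (Olsson.integrand a b₁ b₂ c₁ c₂ x y) Olsson.square ∧
      Olsson.FP a b₁ b₂ c₁ c₂ x y = Olsson.eulerIntegral a b₁ b₂ c₁ c₂ x y) ∧
    Olsson.IsContinuation a b₁ b₂ c₁ c₂
      (fun p => Olsson.eulerIntegral a b₁ b₂ c₁ c₂ p.1 p.2) := by
  have hcont : Olsson.IsContinuation a b₁ b₂ c₁ c₂
      (fun p => Olsson.eulerIntegral a b₁ b₂ c₁ c₂ p.1 p.2) :=
    ⟨Olsson.differentiableOn_eulerIntegral ha hab hbca hbc hcca,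
      fun _ _ hx hy => Olsson.hasSum_term ha hab hbca hbc hcca hx hy⟩
  refine ⟨fun x y hxy => ⟨Olsson.integrableOn_integrand ha hab hbca hbc hcca hxy, ?_⟩, hcont⟩
  have hex : ∃ F : ℂ × ℂ → ℂ, Olsson.IsContinuation a b₁ b₂ c₁ c₂ F := ⟨_, hcont⟩
  rw [Olsson.FP, dif_pos hex]
  -- Uniqueness makes the choice of continuation in `FP` immaterial.
  exact hex.choose_spec.eqOn hcont hxy
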